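/- Let $K$ be a field of prime characteristic $p$, let $R=K[x,y,z,u,v,w]$ with its standard grading, $g_1=yu-xv$, $g_2=zu-xw$, $g_3=zv-yw$, and $S=R/g_1R$ with the induced grading. Let $e\ge 0$ and $q=p^e$. Then the graded $S$-module $S/(g_2^qS+g_3^qS)$ has the minimal graded free resolution $$\cdots \xrightarrow{\phi_5} S^{2q}(-3q-2k)\xrightarrow{\phi_4} S^{2q}(-3q-2k+1)\xrightarrow{\phi_5}\cdots\xrightarrow{\phi_5} S^{2q}(-3q-2)\xrightarrow{\phi_4} S^{2q}(-3q-1)\xrightarrow{\phi_3} S^{q+1}(-3q)\xrightarrow{\phi_2} S^2(-2q)\xrightarrow{\phi_1} S\to 0,$$ augmented by the canonical surjection $S\to S/(g_2^qS+g_3^qS)$, where * $\phi_1=[\,g_2^q,\ g_3^q\,]$; * the columns of $\phi_2$ are $(y^jv^{q-j},\,-x^ju^{q-j})^{T}$ for $0\le j\le q$; * the columns of $\phi_3$ are $U_j=y\,\mathbf e_j-v\,\mathbf e_{j+1}$ and $W_j=x\,\mathbf e_j-u\,\mathbf e_{j+1}$ for $0\le j<q$, where $\mathbf e_0,\dots,\mathbf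 e_q$ is the standard basis of $S^{q+1}$; * with the basis of $S^{2q}$ grouped into $q$ pairs (in $\phi_3$ the $j$-th pair corresponds to $U_j,W_j$), $\phi_4$ and $\phi_5$ are block diagonal with $q$ equal blocks $$\begin{pmatrix} x & u\\ -y & -v\end{pmatrix}\quad\text{and}\quad \begin{pmatrix} v & u\\ -y & -x\end{pmatrix}$$ respectively. That is, the sequence is exact, all maps are homogeneous of degree $0$, and each differential maps the free module $F_{i+1}$ into $S_+F_i$, where $S_+$ is the ideal generated by the elements of positive degree. From $\phi_3$ on all entries of the differentials are linear forms (or zero), and from $\phi_4$ on the differentials are periodic of period $2$. -/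

import Mathlib

noncomputable section

namespace DetRes

open MvPolynomial

section QuotientGrading

variable {K A : Type*} [CommRing K] [CommRing A] [Algebra K A]

/-- The grading of `A ⧸ I` by the images of the graded pieces of `A`. -/
def quotientGrading (𝒜 : ℕ → Submodule K A) (I : Ideal A) (n : ℕ) : Submodule K (A ⧸ I) :=
  (𝒜 n).map (Ideal.Quotient.mkₐ K I).toLinearMap

theorem mk_mem_quotientGrading {𝒜 : ℕ → Submodule K A} {I : Ideal A} {n : ℕ} {a : A}
    (ha : a ∈ 𝒜 n) : Ideal.Quotient.mk I a ∈ quotientGrading 𝒜 I n :=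
  ⟨a, ha, rfl⟩

theorem exists_of_mem_quotientGrading {𝒜 : ℕ → Submodule K A} {I : Ideal A} {n : ℕ} {b : A ⧸ I}
    (hb : b ∈ quotientGrading 𝒜 I n) : ∃ a ∈ 𝒜 n, Ideal.Quotient.mk I a = b :=
  hb

theorem quotientGrading_gradedMonoid (𝒜 : ℕ → Submodule K A) [GradedAlgebra 𝒜] (I : Ideal A) :
    SetLike.GradedMonoid (quotientGrading 𝒜 I) where
  one_mem := ⟨1, SetLike.GradedOne.one_mem, rfl⟩
  mul_mem := by
    rintro i j _ _ ⟨a, ha, rfl⟩ ⟨b, hb, rfl⟩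
    exact ⟨a * b, SetLike.mul_mem_graded ha hb, rfl⟩

theorem quotientGrading_isInternal (𝒜 : ℕ → Submodule K A) [GradedAlgebra 𝒜] {I : Ideal A}
    (hI : I.IsHomogeneous 𝒜) : DirectSum.IsInternal (quotientGrading 𝒜 I) := by
  classical
  constructor
  · rw [injective_iff_map_eq_zero]
    intro f hf
    choose a ha hab using fun i => exists_of_mem_quotientGrading (f i).2
    have hsum : (∑ i ∈ f.support, a i) ∈ I := by
      rw [← Ideal.Quotient.eq_zero_iff_mem, map_sum]
      rw [DirectSum.coeAddMonoidHom_eq_dfinsuppSum, DFinsupp.sum] at hf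
      simpa only [hab] using hf
    ext i
    by_cases hi : i ∈ f.support
    · have h := hI i hsum
      have hc : ((DirectSum.decompose 𝒜 (∑ j ∈ f.support, a j) i : 𝒜 i) : A) = a i := by
        rw [DirectSum.decompose_sum, DFinsupp.finsetSum_apply, AddSubmonoidClass.coe_finsetSum]
        rw [Finset.sum_eq_single i]
        · exact DirectSum.decompose_of_mem_same 𝒜 (ha i)
        · intro j _ hj
          exact DirectSum.decompose_of_mem_ne 𝒜 (ha j) hj
        · exact fun h => absurd hi h
      rw [hc, ← Ideal.Quotient.eq_zero_iff_mem, hab] at h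
      simpa using h
    · have h0 : f i = 0 := by simpa using hi
      rw [h0]; rfl
  · intro b
    obtain ⟨a, rfl⟩ := Ideal.Quotient.mk_surjective b
    refine ⟨∑ i ∈ (DirectSum.decompose 𝒜 a).support,
      DirectSum.of (fun i => quotientGrading 𝒜 I i) i
        ⟨_, mk_mem_quotientGrading (DirectSum.decompose 𝒜 a i).2⟩, ?_⟩
    rw [map_sum]
    simp only [DirectSum.coeAddMonoidHom_of]
    rw [← map_sum, DirectSum.sum_support_decompose]

/-- The quotient of a graded algebra by a homogeneous ideal is a graded algebra. -/
abbrev quotientGradedAlgebra (𝒜 : ℕ → Submodule K A) [GradedAlgebra 𝒜] {I : Ideal A}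
    (hI : I.IsHomogeneous 𝒜) : GradedAlgebra (quotientGrading 𝒜 I) :=
  { quotientGrading_gradedMonoid 𝒜 I, (quotientGrading_isInternal 𝒜 hI).chooseDecomposition with }

end QuotientGrading

section Resolution

variable {K S : Type*} [CommRing K] [CommRing S] [Algebra K S]

/-- The homogeneous elements of degree `n` of the graded free module `⨁ i, S(-a i)`:
the `i`-th coordinate lies in `S_{n - a i}`, which is zero if `n < a i`. -/
def twistedPiece (𝒮 : ℕ → Submodule K S) {ι : Type*} (a : ι → ℕ) (n : ℕ) :
    Submodule K (ι → S) :=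
  Submodule.pi Set.univ fun i => if a i ≤ n then 𝒮 (n - a i) else ⊥

/-- The matrices `d i` and the augmentation `ε` form a minimal graded free resolution
`⋯ → F₂ → F₁ → F₀ → M → 0` of the `S`-module `M` with graded pieces `ℳ n`, where
`F i = ⨁ j : ι i, S(-a i j)`. Minimality means that each differential
maps `F (i + 1)` into `S₊ F i`. -/
structure IsMinimalGradedFreeResolution (𝒮 : ℕ → Submodule K S) [GradedAlgebra 𝒮]
    {M : Type*} [AddCommGroup M] [Module S M] [Module K M] (ℳ : ℕ → Submodule K M)
    (ι : ℕ → Type) [∀ i, Fintype (ι i)] (a : ∀ i, ι i → ℕ)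
    (d : ∀ i, Matrix (ι i) (ι (i + 1)) S) (ε : (ι 0 → S) →ₗ[S] M) : Prop where
  augmentation_surjective : Function.Surjective ε
  exact_zero : Function.Exact (d 0).mulVecLin ε
  exact_succ : ∀ i, Function.Exact (d (i + 1)).mulVecLin (d i).mulVecLin
  augmentation_graded : ∀ n, ∀ f ∈ twistedPiece 𝒮 (a 0) n, ε f ∈ ℳ n
  differential_graded : ∀ i n, ∀ f ∈ twistedPiece 𝒮 (a (i + 1)) n,
    (d i).mulVecLin f ∈ twistedPiece 𝒮 (a i) n
  minimal : ∀ i, LinearMap.range (d i).mulVecLin ≤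
    (HomogeneousIdeal.irrelevant 𝒮).toIdeal • (⊤ : Submodule S (ι i → S))

end Resolution

section Example

variable (K : Type*) [Field K]

/-- The polynomial ring `K[x, y, z, u, v, w]`, the variables being `X 0, …, X 5` in this order. -/
abbrev R : Type _ := MvPolynomial (Fin 6) K

/-- `g₁ = y u - x v`. -/
def g₁ : R K := X 1 * X 3 - X 0 * X 4

/-- `g₂ = z u - x w`. -/
def g₂ : R K := X 2 * X 3 - X 0 * X 5

/-- `g₃ = z v - y w`. -/
def g₃ : R K := X 2 * X 4 - X 1 * X 5

/-- The hypersurface ring `S = R / (y u - x v)`. -/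
abbrev S : Type _ := R K ⧸ Ideal.span {g₁ K}

/-- The class in `S` of a polynomial. -/
abbrev toS : R K →+* S K := Ideal.Quotient.mk _

/-- The grading of `S` induced by the standard grading of `R`. -/
def gradingS : ℕ → Submodule K (S K) :=
  quotientGrading (homogeneousSubmodule (Fin 6) K) (Ideal.span {g₁ K})

instance : GradedAlgebra (homogeneousSubmodule (Fin 6) K) :=
  MvPolynomial.gradedAlgebra

theorem isHomogeneous_span_g₁ :
    (Ideal.span {g₁ K}).IsHomogeneous (homogeneousSubmodule (Fin 6) K) := by
  apply Ideal.homogeneous_span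
  rintro f rfl
  exact ⟨2, ((isHomogeneous_X K 1).mul (isHomogeneous_X K 3)).sub
    ((isHomogeneous_X K 0).mul (isHomogeneous_X K 4))⟩

instance : GradedAlgebra (gradingS K) :=
  quotientGradedAlgebra (homogeneousSubmodule (Fin 6) K) (isHomogeneous_span_g₁ K)

variable (q : ℕ)

/-- The ideal `(g₂ ^ q, g₃ ^ q)` of `S`. -/
def J : Ideal (S K) := Ideal.span {toS K (g₂ K) ^ q, toS K (g₃ K) ^ q}

/-- The index sets of bases of the free modules, of sizes `1, 2, q + 1, 2 q, 2 q, …`. -/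
def idx (q : ℕ) : ℕ → Type
  | 0 => Fin 1
  | 1 => Fin 2
  | 2 => Fin (q + 1)
  | _ + 3 => Fin 2 × Fin q

instance instFintypeIdx (q : ℕ) : ∀ i, Fintype (idx q i)
  | 0 => inferInstanceAs (Fintype (Fin 1))
  | 1 => inferInstanceAs (Fintype (Fin 2))
  | 2 => inferInstanceAs (Fintype (Fin (q + 1)))
  | _ + 3 => inferInstanceAs (Fintype (Fin 2 × Fin q))

/-- All basis elements of the `i`-th free module have this degree:
`0, 2 q, 3 q, 3 q + 1, 3 q + 2, …`. -/
def shift (q : ℕ) : ℕ → ℕ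
  | 0 => 0
  | 1 => 2 * q
  | 2 => 3 * q
  | k + 3 => 3 * q + (k + 1)

/-- `[g₂ ^ q, g₃ ^ q]`. -/
def φ₁ : Matrix (Fin 1) (Fin 2) (S K) := !![toS K (g₂ K) ^ q, toS K (g₃ K) ^ q]

/-- The columns are `(y ^ j v ^ (q - j), - x ^ j u ^ (q - j))`, `0 ≤ j ≤ q`. -/
def φ₂ : Matrix (Fin 2) (Fin (q + 1)) (S K) :=
  Matrix.of ![fun j => toS K (X 1 ^ (j : ℕ) * X 4 ^ (q - j)),
    fun j => - toS K (X 0 ^ (j : ℕ) * X 3 ^ (q - j))]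

/-- The column indexed by `(0, j)` is `y e_j - v e_{j + 1}` and
the one indexed by `(1, j)` is `x e_j - u e_{j + 1}`, `0 ≤ j < q`. -/
def φ₃ : Matrix (Fin (q + 1)) (Fin 2 × Fin q) (S K) :=
  Matrix.of fun i c =>
    if i = c.2.castSucc then toS K (![X 1, X 0] c.1)
    else if i = c.2.succ then - toS K (![X 4, X 3] c.1)
    else 0

/-- The block diagonal matrix with `q` blocks with columns `(x, -y)` and `(u, -v)`. -/
def φ₄ : Matrix (Fin 2 × Fin q) (Fin 2 × Fin q) (S K) :=
  Matrix.blockDiagonal fun _ =>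
    !![toS K (X 0), toS K (X 3); - toS K (X 1), - toS K (X 4)]

/-- The block diagonal matrix with `q` blocks with columns `(v, -y)` and `(u, -x)`. -/
def φ₅ : Matrix (Fin 2 × Fin q) (Fin 2 × Fin q) (S K) :=
  Matrix.blockDiagonal fun _ =>
    !![toS K (X 4), toS K (X 3); - toS K (X 1), - toS K (X 0)]

/-- The differentials `φ₁, φ₂, φ₃, φ₄, φ₅, φ₄, φ₅, …`. -/
def differential : ∀ i, Matrix (idx q i) (idx q (i + 1)) (S K)
  | 0 => φ₁ K q
  | 1 => φ₂ K q
  | 2 => φ₃ K q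
  | k + 3 => if Even k then φ₄ K q else φ₅ K q

/-- The augmentation `S → S / (g₂ ^ q, g₃ ^ q)`. -/
def augmentation : (idx q 0 → S K) →ₗ[S K] (S K ⧸ J K q) :=
  (J K q).mkQ ∘ₗ LinearMap.proj (0 : Fin 1)

end Example

end DetRes

end

noncomputable section

namespace DetRes

open MvPolynomial

/-! ### Graded pieces and minimality read off from the entries of a matrix. -/

section General

variable {K S : Type*} [CommRing K] [CommRing S] [Algebra K S]

/-! The Segre parametrization x = as, y = bs, u = at, v = bt embeds S in the factorial domain
K[a,b,s,t,z,w] (`segre_injective`). Giving a, b weight 1, s, t weight -1 and z, w weight 0, its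
image is exactly the part of weight 0 (`exists_segre_eq`, `segre_mem_weightPart`). As S-modules, the
part of weight 1 is generated by a, b and the part of weight -q by the s^j t^(q-j)
(`exists_segre_of_weight_one`, `exists_segre_of_weight_neg`).

Over the big ring every differential becomes transparent. With m = tz - sw one has g₂ = am and g₃ =
bm, so a syzygy of g₂^q, g₃^q is one of a^q, b^q, namely γ(b^q, -a^q) with γ of weight -q; expanding
γ in its generators gives φ₂. Syzygies of the s^j t^(q-j) are combinations of s e_j - t e_{j+1} with
coefficients d_j of weight 1 (`exists_eq_snoc_sub_cons`), and d_j = aα + bβ gives φ₃.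

From there on the problem splits into q identical blocks. The kernel of φ₃ is given blockwise by b
f₀ + a f₁ = 0, that is f = γ(a, -b) with γ of weight -1, which is the image of φ₄. The kernel of φ₄
is given by s f₀ + t f₁ = 0, that is f = γ(t, -s) with γ of weight 1, which is the image of φ₅. The
kernel of φ₅ is again b f₀ + a f₁ = 0, whence the period 2.

Homogeneity and minimality follow because all entries of each differential lie in a single degree,
which is positive since q > 0. -/

theorem mulVec_mem_twistedPiece (𝒮 : ℕ → Submodule K S) [SetLike.GradedMonoid 𝒮]
    {ι κ : Type*} [Fintype κ] {A : Matrix ι κ S} {r s m : ℕ} (hs : s = r + m)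
    (hA : ∀ i j, A i j ∈ 𝒮 m) {n : ℕ} {f : κ → S} (hf : f ∈ twistedPiece 𝒮 (fun _ => s) n) :
    A.mulVecLin f ∈ twistedPiece 𝒮 (fun _ => r) n := by
  simp only [twistedPiece, Submodule.mem_pi, Set.mem_univ, true_implies] at hf ⊢
  intro i
  rw [Matrix.mulVecLin_apply, Matrix.mulVec, dotProduct]
  refine Submodule.sum_mem _ fun j _ => ?_
  have hj := hf j
  by_cases h : s ≤ n
  · rw [if_pos h] at hj
    rw [if_pos (by omega), show n - r = m + (n - s) by omega]
    exact SetLike.mul_mem_graded (hA i j) hj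
  · rw [if_neg h, Submodule.mem_bot] at hj
    rw [hj, mul_zero]
    exact Submodule.zero_mem _

theorem range_mulVecLin_le_smul_top {ι κ : Type*} [Fintype ι] [Fintype κ] (I : Ideal S)
    {A : Matrix ι κ S} (hA : ∀ i j, A i j ∈ I) :
    LinearMap.range A.mulVecLin ≤ I • (⊤ : Submodule S (ι → S)) := by
  classical
  rintro _ ⟨f, rfl⟩
  rw [pi_eq_sum_univ' (A.mulVecLin f)]
  refine Submodule.sum_mem _ fun i _ => Submodule.smul_mem_smul ?_ trivial
  rw [Matrix.mulVecLin_apply, Matrix.mulVec, dotProduct]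
  exact Submodule.sum_mem _ fun j _ => I.mul_mem_right _ (hA i j)

end General

/-! ### The Segre embedding of S and its injectivity. -/

section Segre

variable (K : Type*) [Field K]

/-- The weights for which the Segre subring of `K[a, b, s, t, z, w]` is the part of weight zero. -/
def segreWeight : Fin 6 → ℤ := ![1, 1, -1, -1, 0, 0]

/-- The polynomials in `K[a, b, s, t, z, w]` of weight `n`. -/
abbrev weightPart (n : ℤ) : Submodule K (R K) := weightedHomogeneousSubmodule K segreWeight n

/-- The map `x ↦ a s, y ↦ b s, z ↦ z, u ↦ a t, v ↦ b t, w ↦ w` into `K[a, b, s, t, z, w]`. -/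
def segreR : R K →ₐ[K] R K :=
  aeval ![X 0 * X 2, X 1 * X 2, X 4, X 0 * X 3, X 1 * X 3, X 5]

/-- The map induced by `segreR` on `S`. -/
def segre : S K →+* R K :=
  Ideal.Quotient.lift _ (segreR K : R K →+* R K) <| by
    intro f hf
    obtain ⟨c, rfl⟩ := Ideal.mem_span_singleton'.1 hf
    simp [g₁, segreR]
    right; ring

variable {K}

theorem segre_toS (f : R K) : segre K (toS K f) = segreR K f := rfl

@[simp] theorem segre_x : segre K (toS K (X 0)) = X 0 * X 2 := by simp [segre_toS, segreR]
@[simp] theorem segre_y : segre K (toS K (X 1)) = X 1 * X 2 := by simp [segre_toS, segreR]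
@[simp] theorem segre_z : segre K (toS K (X 2)) = X 4 := by simp [segre_toS, segreR]
@[simp] theorem segre_u : segre K (toS K (X 3)) = X 0 * X 3 := by simp [segre_toS, segreR]
@[simp] theorem segre_v : segre K (toS K (X 4)) = X 1 * X 3 := by simp [segre_toS, segreR]
@[simp] theorem segre_w : segre K (toS K (X 5)) = X 5 := by simp [segre_toS, segreR]

theorem monomial_eq_prod (m : Fin 6 →₀ ℕ) : (monomial m 1 : R K) =
    X 0 ^ m 0 * X 1 ^ m 1 * X 2 ^ m 2 * X 3 ^ m 3 * X 4 ^ m 4 * X 5 ^ m 5 := by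
  rw [monomial_eq, Finsupp.prod_fintype _ _ (by simp)]
  simp [Fin.prod_univ_succ, mul_assoc]

theorem toS_relation : toS K (X 1) * toS K (X 3) = toS K (X 0) * toS K (X 4) := by
  rw [← map_mul, ← map_mul, Ideal.Quotient.eq]
  exact Ideal.subset_span rfl

/-- A left inverse of `segre`, given on monomials by standard monomials of `S`. -/
def segreInv (K : Type*) [Field K] : R K →ₗ[K] S K :=
  (basisMonomials (Fin 6) K).constr K fun m =>
    toS K (X 0) ^ min (m 0) (m 2) * toS K (X 1) ^ (m 2 - m 0) * toS K (X 3) ^ (m 0 - m 2) *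
      toS K (X 4) ^ (m 1 - (m 2 - m 0)) * toS K (X 2) ^ m 4 * toS K (X 5) ^ m 5

/-- Straightening: yu is replaced by xv until y or u has disappeared. The exponents on the left,
with truncated subtraction, depend only on those of a, b, s in the image monomial; this is why
`segreInv` can recover the class. -/
theorem standard_monomial {A : Type*} [CommMonoid A] {x y u v : A} (h : y * u = x * v)
    (i j k l : ℕ) :
    x ^ min (i + k) (i + j) * y ^ ((i + j) - (i + k)) * u ^ ((i + k) - (i + j)) *
      v ^ ((j + l) - ((i + j) - (i + k))) = x ^ i * y ^ j * u ^ k * v ^ l := by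
  have key : ∀ n, y ^ n * u ^ n = x ^ n * v ^ n := fun n => by rw [← mul_pow, h, mul_pow]
  rcases le_total j k with hjk | hjk
  · obtain ⟨m, rfl⟩ := Nat.exists_eq_add_of_le hjk
    rw [min_eq_right (by omega), show i + j - (i + (j + m)) = 0 by omega,
      show i + (j + m) - (i + j) = m by omega, show j + l - 0 = j + l by omega]
    calc _ = (x ^ j * v ^ j) * (x ^ i * u ^ m * v ^ l) := by
          simp only [pow_add, pow_zero, mul_one]; ac_rfl
      _ = _ := by rw [← key]; simp only [pow_add]; ac_rfl
  · obtain ⟨m, rfl⟩ := Nat.exists_eq_add_of_le hjk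
    rw [min_eq_left (by omega), show i + k - (i + (k + m)) = 0 by omega,
      show i + (k + m) - (i + k) = m by omega, show k + m + l - m = k + l by omega]
    calc _ = (x ^ k * v ^ k) * (x ^ i * y ^ m * v ^ l) := by
          simp only [pow_add, pow_zero, mul_one]; ac_rfl
      _ = _ := by rw [← key]; simp only [pow_add]; ac_rfl

theorem segreR_monomial (m : Fin 6 →₀ ℕ) :
    segreR K (monomial m 1) = monomial (Finsupp.equivFunOnFinite.symm
      ![m 0 + m 3, m 1 + m 4, m 0 + m 1, m 3 + m 4, m 2, m 5]) 1 := by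
  rw [monomial_eq_prod, monomial_eq_prod]
  simp [segreR]
  ring

theorem segreInv_segreR (f : R K) : segreInv K (segreR K f) = toS K f := by
  have : segreInv K ∘ₗ (segreR K).toLinearMap =
      (Ideal.Quotient.mkₐ K (Ideal.span {g₁ K})).toLinearMap := by
    refine (basisMonomials (Fin 6) K).ext fun m => ?_
    have h := (basisMonomials (Fin 6) K).constr_basis K (fun m =>
      toS K (X 0) ^ min (m 0) (m 2) * toS K (X 1) ^ (m 2 - m 0) * toS K (X 3) ^ (m 0 - m 2) *
      toS K (X 4) ^ (m 1 - (m 2 - m 0)) * toS K (X 2) ^ m 4 * toS K (X 5) ^ m 5)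
      (Finsupp.equivFunOnFinite.symm ![m 0 + m 3, m 1 + m 4, m 0 + m 1, m 3 + m 4, m 2, m 5])
    rw [coe_basisMonomials] at h
    change segreInv K (segreR K (monomial m 1)) = toS K (monomial m 1)
    rw [segreR_monomial, segreInv, h, monomial_eq_prod]
    simp only [Finsupp.equivFunOnFinite_symm_apply_apply, Matrix.cons_val, map_mul, map_pow]
    rw [standard_monomial toS_relation]
    ring
  exact LinearMap.congr_fun this f

theorem segre_injective : Function.Injective (segre K) := by
  refine Function.LeftInverse.injective (g := segreInv K) fun s => ?_
  obtain ⟨f, rfl⟩ := Ideal.Quotient.mk_surjective s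
  exact segreInv_segreR f

end Segre

/-! ### The weight grading: weight 0 is S, weights 1 and -q are S-modules with known generators. -/

section Weights

variable {K : Type*} [Field K]

theorem weight_segreWeight (m : Fin 6 →₀ ℕ) :
    Finsupp.weight segreWeight m = (m 0 + m 1 : ℤ) - (m 2 + m 3) := by
  rw [Finsupp.weight_apply, Finsupp.sum_fintype _ _ (by simp)]
  simp [Fin.sum_univ_succ, segreWeight]
  ring

theorem X_mul_mem_weightPart {n m : ℤ} {i : Fin 6} (h : m = segreWeight i + n) {f : R K}
    (hf : f ∈ weightPart K n) : X i * f ∈ weightPart K m := by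
  subst h
  exact (isWeightedHomogeneous_X K segreWeight i).mul hf

/-- Multiplication by a variable only shifts exponents, so weights can be cancelled. This determines
the weight of the cofactor γ each time a divisibility argument produces one. -/
theorem mem_weightPart_of_X_mul {n m : ℤ} {i : Fin 6} (h : m = segreWeight i + n) {f : R K}
    (hf : X i * f ∈ weightPart K m) : f ∈ weightPart K n := by
  intro d hd
  have h1 := @hf (Finsupp.single i 1 + d) (by rwa [coeff_X_mul])
  rw [map_add, Finsupp.weight_single, one_smul, h] at h1
  exact add_left_cancel h1

theorem mem_weightPart_of_X_pow_mul {n m : ℤ} {i : Fin 6} {k : ℕ} (h : m = k * segreWeight i + n)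
    {f : R K} (hf : X i ^ k * f ∈ weightPart K m) : f ∈ weightPart K n := by
  induction k generalizing m with
  | zero => simpa [h] using hf
  | succ k ih =>
    rw [pow_succ', mul_assoc] at hf
    exact ih rfl (mem_weightPart_of_X_mul (by rw [h]; push_cast; ring) hf)

theorem weightPart_le {n : ℤ} {N : Submodule K (R K)}
    (h : ∀ m : Fin 6 →₀ ℕ, (m 0 + m 1 : ℤ) - (m 2 + m 3) = n → monomial m 1 ∈ N) :
    weightPart K n ≤ N := by
  intro f hf
  rw [f.as_sum]
  refine Submodule.sum_mem _ fun m hm => ?_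
  have h1 := h m (by rw [← weight_segreWeight]; exact hf (mem_support_iff.1 hm))
  simpa [smul_monomial] using N.smul_mem (coeff m f) h1

theorem monomial_mem_weightPart {n : ℤ} {m : Fin 6 →₀ ℕ}
    (h : (m 0 + m 1 : ℤ) - (m 2 + m 3) = n) : monomial m (1 : K) ∈ weightPart K n :=
  isWeightedHomogeneous_monomial _ _ _ (by rw [weight_segreWeight, h])

theorem exists_monomial_eq_X_mul (m : Fin 6 →₀ ℕ) {i : Fin 6} (h : 0 < m i) :
    ∃ m' : Fin 6 →₀ ℕ, m = Finsupp.single i 1 + m' ∧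
      (monomial m 1 : R K) = X i * monomial m' 1 := by
  obtain ⟨m', rfl⟩ := exists_add_of_le (Finsupp.single_le_iff.2 (Nat.succ_le_of_lt h))
  exact ⟨m', rfl, by rw [X, monomial_mul, one_mul]⟩

/-- By `H` every monomial of the given weight is divisible by one of the two variables, and the
quotient has the right weight; linearity does the rest. -/
theorem exists_eq_X_mul_add_X_mul {n n' : ℤ} {i j : Fin 6} (hi : n' = segreWeight i + n)
    (hj : n' = segreWeight j + n)
    (H : ∀ m : Fin 6 →₀ ℕ, (m 0 + m 1 : ℤ) - (m 2 + m 3) = n' → 0 < m i ∨ 0 < m j)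
    {f : R K} (hf : f ∈ weightPart K n') :
    ∃ g ∈ weightPart K n, ∃ h ∈ weightPart K n, f = X i * g + X j * h := by
  have key : weightPart K n' ≤ (weightPart K n).map (LinearMap.mulLeft K (X i)) ⊔
      (weightPart K n).map (LinearMap.mulLeft K (X j)) := by
    refine weightPart_le fun m hm => ?_
    have hm' : monomial m (1 : K) ∈ weightPart K n' := monomial_mem_weightPart hm
    rcases H m hm with h | h
    · obtain ⟨m', -, h2⟩ := exists_monomial_eq_X_mul (K := K) m h
      rw [h2] at hm' ⊢
      exact Submodule.mem_sup_left ⟨_, mem_weightPart_of_X_mul hi hm', rfl⟩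
    · obtain ⟨m', -, h2⟩ := exists_monomial_eq_X_mul (K := K) m h
      rw [h2] at hm' ⊢
      exact Submodule.mem_sup_right ⟨_, mem_weightPart_of_X_mul hj hm', rfl⟩
  obtain ⟨_, ⟨g, hg, rfl⟩, _, ⟨h, hh, rfl⟩, rfl⟩ := Submodule.mem_sup.1 (key hf)
  exact ⟨g, hg, h, hh, rfl⟩

/-- Weight 0 means that factors a, b are as many as factors s, t. Pair one of each and split off the
product, which is the image of x, y, u or v. -/
theorem monomial_mem_range_segre (d : ℕ) (m : Fin 6 →₀ ℕ) (h : m 0 + m 1 = d)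
    (h' : m 2 + m 3 = d) : (monomial m 1 : R K) ∈ (segre K).range := by
  induction d generalizing m with
  | zero =>
    refine ⟨toS K (X 2) ^ m 4 * toS K (X 5) ^ m 5, ?_⟩
    rw [monomial_eq_prod, show m 0 = 0 by omega, show m 1 = 0 by omega, show m 2 = 0 by omega,
      show m 3 = 0 by omega]
    simp
  | succ d ih =>
    have h1 : 0 < m 0 ∨ 0 < m 1 := by omega
    have h2 : 0 < m 2 ∨ 0 < m 3 := by omega
    have key : ∀ i j : Fin 6, (i = 0 ∨ i = 1) → (j = 2 ∨ j = 3) → 0 < m i → 0 < m j →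
        (X i * X j : R K) ∈ (segre K).range → (monomial m 1 : R K) ∈ (segre K).range := by
      intro i j hij hj hmi hmj hr
      obtain ⟨m', hm', he⟩ := exists_monomial_eq_X_mul (K := K) m hmi
      have hmj' : 0 < m' j := by
        rw [hm', Finsupp.add_apply, Finsupp.single_apply, if_neg] at hmj
        · omega
        · rintro rfl
          rcases hij with rfl | rfl <;> simp at hj
      obtain ⟨m'', hm'', he'⟩ := exists_monomial_eq_X_mul (K := K) m' hmj'
      rw [he, he', ← mul_assoc]
      refine Subring.mul_mem _ hr (ih m'' ?_ ?_)
      · rcases hij with rfl | rfl <;> rcases hj with rfl | rfl <;>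
          simp [hm', hm''] at h <;> omega
      · rcases hij with rfl | rfl <;> rcases hj with rfl | rfl <;>
          simp [hm', hm''] at h' <;> omega
    rcases h1 with h1 | h1 <;> rcases h2 with h2 | h2
    · exact key 0 2 (.inl rfl) (.inl rfl) h1 h2 ⟨_, segre_x⟩
    · exact key 0 3 (.inl rfl) (.inr rfl) h1 h2 ⟨_, segre_u⟩
    · exact key 1 2 (.inr rfl) (.inl rfl) h1 h2 ⟨_, segre_y⟩
    · exact key 1 3 (.inr rfl) (.inr rfl) h1 h2 ⟨_, segre_v⟩

theorem exists_segre_eq {f : R K} (hf : f ∈ weightPart K 0) : ∃ s, segre K s = f := by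
  -- The range is taken of the K-algebra version of `segre`, so that it is a K-subspace and can be
  -- tested on monomials.
  have key : weightPart K 0 ≤ Subalgebra.toSubmodule
      ((Ideal.Quotient.liftₐ (Ideal.span {g₁ K}) (segreR K) fun a ha =>
        (Ideal.Quotient.eq_zero_iff_mem.2 ha ▸ map_zero (segre K) :
          segre K (toS K a) = 0)).range) :=
    weightPart_le fun m hm => monomial_mem_range_segre _ m rfl (by omega)
  exact key hf

theorem segre_mem_weightPart (s : S K) : segre K s ∈ weightPart K 0 := by
  obtain ⟨f, rfl⟩ := Ideal.Quotient.mk_surjective s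
  change segreR K f ∈ weightPart K 0
  induction f using MvPolynomial.induction_on' with
  | monomial m c =>
    rw [← mul_one c, ← smul_eq_mul, ← smul_monomial, map_smul, segreR_monomial]
    refine Submodule.smul_mem _ _ (monomial_mem_weightPart ?_)
    simp
    ring
  | add f g hf hg => rw [map_add]; exact Submodule.add_mem _ hf hg

theorem exists_segre_of_weight_one {f : R K} (hf : f ∈ weightPart K 1) :
    ∃ α β : S K, f = X 0 * segre K α + X 1 * segre K β := by
  obtain ⟨g, hg, h, hh, rfl⟩ := exists_eq_X_mul_add_X_mul (n := 0) (n' := 1) (i := 0) (j := 1) rfl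
    rfl     (fun m hm => by omega) hf
  obtain ⟨α, rfl⟩ := exists_segre_eq hg
  obtain ⟨β, rfl⟩ := exists_segre_eq hh
  exact ⟨α, β, rfl⟩

theorem exists_segre_of_weight_neg {q : ℕ} {f : R K} (hf : f ∈ weightPart K (-q)) :
    ∃ c : Fin (q + 1) → S K, f = ∑ j : Fin (q + 1), X 2 ^ (j : ℕ) * X 3 ^ (q - j) * segre K (c j) := by
  induction q generalizing f with
  | zero =>
    obtain ⟨α, rfl⟩ := exists_segre_eq (by simpa using hf)
    exact ⟨fun _ => α, by simp⟩
  | succ q ih =>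
    obtain ⟨g, hg, h, hh, rfl⟩ := exists_eq_X_mul_add_X_mul (n := -q) (i := 2) (j := 3)
      (by simp [segreWeight]) (by simp [segreWeight]) (fun m hm => by omega) hf
    obtain ⟨c, rfl⟩ := ih hg
    obtain ⟨c', rfl⟩ := ih hh
    -- Here f = s g + t h: multiplying by s raises the index of each generator by one, while
    -- multiplying by t keeps it.
    refine ⟨Fin.cons 0 c + Fin.snoc (α := fun _ => S K) c' 0, ?_⟩
    simp only [Pi.add_apply, map_add, mul_add, Finset.sum_add_distrib]
    congr 1
    · rw [Finset.mul_sum, Fin.sum_univ_succ (n := q + 1)]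
      simp only [Fin.cons_zero, map_zero, mul_zero, zero_add, Fin.cons_succ, Fin.val_succ,
        Nat.add_sub_add_right]
      exact Finset.sum_congr rfl fun j _ => by ring
    · rw [Finset.mul_sum, Fin.sum_univ_castSucc (n := q + 1)]
      simp only [Fin.snoc_last, map_zero, mul_zero, add_zero, Fin.snoc_castSucc, Fin.val_castSucc]
      refine Finset.sum_congr rfl fun j _ => ?_
      rw [Nat.sub_add_comm (Nat.le_of_lt_succ j.2)]
      ring

end Weights

/-! ### Syzygies of a coprime pair and of the powers s^j t^(n-j) in a domain. -/

section Syzygies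

variable {A : Type*} [CommRing A] [IsDomain A]

theorem exists_eq_mul_of_mul_add_mul_eq_zero {a b α β : A} (ha : Prime a) (hb : ¬ a ∣ b)
    (h : b * α + a * β = 0) : ∃ γ, α = a * γ ∧ β = - (b * γ) := by
  have h1 : a ∣ b * α := ⟨-β, by linear_combination h⟩
  obtain ⟨γ, rfl⟩ := (ha.dvd_or_dvd h1).resolve_left hb
  exact ⟨γ, rfl, mul_left_cancel₀ ha.ne_zero (by linear_combination h)⟩

/-- The relation forces s to divide c₀, say c₀ = s d₀. Subtracting d₀(s e₀ - t e₁) replaces c₁ by c₁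
+ t d₀, and cancelling s leaves a relation of length one less. `M₀` and `M₁` keep track of weights 0
and 1 along the way. -/
theorem exists_eq_snoc_sub_cons {s t : A} (hs : Prime s) (ht : ¬ s ∣ t) {M₀ M₁ : AddSubgroup A}
    (h01 : ∀ f, s * f ∈ M₀ → f ∈ M₁) (h10 : ∀ f ∈ M₁, t * f ∈ M₀) (n : ℕ) (c : Fin (n + 1) → A)
    (hc : ∀ i, c i ∈ M₀) (h : ∑ j : Fin (n + 1), s ^ (j : ℕ) * t ^ (n - j) * c j = 0) :
    ∃ d : Fin n → A, (∀ i, d i ∈ M₁) ∧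
      c = Fin.snoc (α := fun _ => A) (fun j => s * d j) 0 - Fin.cons 0 (fun j => t * d j) := by
  induction n with
  | zero =>
    refine ⟨Fin.elim0, fun i => i.elim0, ?_⟩
    ext i
    fin_cases i
    simpa [Fin.snoc] using h
  | succ n ih =>
    have h' : t ^ (n + 1) * c 0 +
        s * ∑ j : Fin (n + 1), s ^ (j : ℕ) * t ^ (n - j) * c j.succ = 0 := by
      rw [← h, Finset.mul_sum, Fin.sum_univ_succ (n := n + 1)]
      congr 1
      · simp
      · refine Finset.sum_congr rfl fun j _ => ?_
        rw [Fin.val_succ, Nat.add_sub_add_right]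
        ring
    obtain ⟨d₀, hd₀, hsum⟩ := exists_eq_mul_of_mul_add_mul_eq_zero hs
      (fun h => ht (hs.dvd_of_dvd_pow h)) h'
    have hd₀M : d₀ ∈ M₁ := h01 _ (hd₀ ▸ hc 0)
    -- The relation `hsum` that is left after cancelling s, with t d₀ absorbed in its first
    -- coefficient.
    obtain ⟨d, hdM, hd⟩ := ih (Fin.cons (c 1 + t * d₀) fun j => c j.succ.succ)
      (fun i => by
        refine Fin.cases ?_ (fun i => ?_) i
        · exact M₀.add_mem (hc 1) (h10 _ hd₀M)
        · exact hc _) <| by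
      rw [Fin.sum_univ_succ] at hsum ⊢
      simp only [Fin.cons_zero, Fin.cons_succ, Fin.val_zero, pow_zero, one_mul, Nat.sub_zero,
        Fin.succ_zero_eq_one] at hsum ⊢
      linear_combination hsum
    refine ⟨Fin.cons d₀ d, fun i => Fin.cases hd₀M hdM i, ?_⟩
    ext i
    refine Fin.cases ?_ (fun i => ?_) i
    · rw [Pi.sub_apply, ← Fin.castSucc_zero, Fin.snoc_castSucc, Fin.castSucc_zero]
      simpa using hd₀
    · have h1 : (fun j => s * (Fin.cons d₀ d : Fin (n + 1) → A) j) =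
          Fin.cons (s * d₀) (fun j => s * d j) := by
        ext j
        refine Fin.cases rfl (fun j => rfl) j
      rw [Pi.sub_apply, h1, ← Fin.cons_snoc_eq_snoc_cons, Fin.cons_succ, Fin.cons_succ]
      have h2 := congr_fun hd i
      rw [Pi.sub_apply] at h2
      refine Fin.cases (fun h2 => ?_) (fun i h2 => ?_) i h2
      · simp only [Fin.cons_zero, Fin.succ_zero_eq_one] at h2 ⊢
        linear_combination h2
      · simpa only [Fin.cons_succ] using h2

/-- The coordinates read s d₀ = 0 and s d_j = t d_{j-1}, so the d_j vanish one after another. -/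
theorem eq_zero_of_snoc_sub_cons_eq_zero {s t : A} (hs : s ≠ 0) (n : ℕ) (d : Fin n → A)
    (h : (Fin.snoc (α := fun _ => A) (fun j => s * d j) 0 : Fin (n + 1) → A) -
      Fin.cons 0 (fun j => t * d j) = 0) : d = 0 := by
  ext ⟨j, hj⟩
  induction j with
  | zero =>
    have := congr_fun h (Fin.castSucc ⟨0, hj⟩)
    obtain ⟨n, rfl⟩ : ∃ m, n = m + 1 := ⟨n - 1, by omega⟩
    rw [Pi.sub_apply, Fin.snoc_castSucc] at this
    change s * _ - 0 = 0 at this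
    simpa [hs] using this
  | succ j ih =>
    have := congr_fun h (Fin.castSucc ⟨j + 1, hj⟩)
    rw [Pi.sub_apply, Fin.snoc_castSucc] at this
    change s * _ - t * d ⟨j, _⟩ = 0 at this
    rw [ih (by omega)] at this
    simpa [hs] using this

end Syzygies

/-! ### Kernel and image of a block diagonal matrix, block by block. -/

section BlockDiagonal

variable {A m n o : Type*} [CommRing A] [Fintype n] [Fintype o] [DecidableEq o]

theorem blockDiagonal_mulVec (M : o → Matrix m n A) (f : n × o → A) (i : m) (k : o) :
    (Matrix.blockDiagonal M).mulVec f (i, k) = (M k).mulVec (fun j => f (j, k)) i := by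
  simp [Matrix.mulVec, dotProduct, Fintype.sum_prod_type, Matrix.blockDiagonal_apply]

theorem blockDiagonal_mulVec_eq_zero_iff (M : o → Matrix m n A) (f : n × o → A) :
    (Matrix.blockDiagonal M).mulVecLin f = 0 ↔ ∀ k, (M k).mulVec (fun j => f (j, k)) = 0 := by
  constructor
  · intro h k
    ext i
    rw [← blockDiagonal_mulVec]
    exact congr_fun h (i, k)
  · intro h
    ext ⟨i, k⟩
    rw [Matrix.mulVecLin_apply, blockDiagonal_mulVec, h]
    rfl

theorem mem_range_blockDiagonal_iff (M : o → Matrix m n A) (f : m × o → A) :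
    f ∈ Set.range (Matrix.blockDiagonal M).mulVecLin ↔
      ∀ k, ∃ g, (M k).mulVec g = fun j => f (j, k) := by
  constructor
  · rintro ⟨g, rfl⟩ k
    exact ⟨fun j => g (j, k), funext fun i => (blockDiagonal_mulVec M g i k).symm⟩
  · intro h
    choose g hg using h
    refine ⟨fun c => g c.2 c.1, ?_⟩
    ext ⟨i, k⟩
    rw [Matrix.mulVecLin_apply, blockDiagonal_mulVec]
    exact congr_fun (hg k) i

end BlockDiagonal

/-! ### Kernels and images of the differentials, computed after the Segre embedding. -/

section Exactness

variable {K : Type*} [Field K]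

theorem not_X_dvd_X {i j : Fin 6} (h : i ≠ j) : ¬ (X i : R K) ∣ X j := by
  rwa [X_dvd_X]

/-- The columns are s(a, -b) and t(a, -b), so the image consists of the γ(a, -b) with γ of weight
-1. These are all the weight 0 syzygies of (b, a). -/
theorem exists_mulVec_eq_iff_of_ab (f : Fin 2 → S K) :
    (∃ g, (!![toS K (X 0), toS K (X 3); - toS K (X 1), - toS K (X 4)]).mulVec g = f) ↔
      X 1 * segre K (f 0) + X 0 * segre K (f 1) = 0 := by
  constructor
  · rintro ⟨g, rfl⟩
    simp [Matrix.mulVec, dotProduct, Fin.sum_univ_two]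
    ring
  · intro h
    obtain ⟨γ, h0, h1⟩ := exists_eq_mul_of_mul_add_mul_eq_zero (X_prime (i := 0))
      (not_X_dvd_X (by decide)) h
    have hγ : γ ∈ weightPart K (-(1 : ℕ)) :=
      mem_weightPart_of_X_mul (i := 0) (by simp [segreWeight]) (h0 ▸ segre_mem_weightPart (f 0))
    obtain ⟨c, rfl⟩ := exists_segre_of_weight_neg hγ
    -- The index of `c` is the exponent of s, so `c 1` belongs to the column s(a, -b).
    refine ⟨![c 1, c 0], funext fun i => segre_injective ?_⟩
    fin_cases i
    · simp [Matrix.mulVec, dotProduct, Fin.sum_univ_two, h0]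
      ring
    · simp [Matrix.mulVec, dotProduct, Fin.sum_univ_two, h1]
      ring

/-- The columns are b(t, -s) and a(t, -s), so the image consists of the γ(t, -s) with γ of weight 1.
-/
theorem exists_mulVec_eq_iff_of_st (f : Fin 2 → S K) :
    (∃ g, (!![toS K (X 4), toS K (X 3); - toS K (X 1), - toS K (X 0)]).mulVec g = f) ↔
      X 2 * segre K (f 0) + X 3 * segre K (f 1) = 0 := by
  constructor
  · rintro ⟨g, rfl⟩
    simp [Matrix.mulVec, dotProduct, Fin.sum_univ_two]
    ring
  · intro h
    obtain ⟨γ, h0, h1⟩ := exists_eq_mul_of_mul_add_mul_eq_zero (X_prime (i := 3))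
      (not_X_dvd_X (by decide)) h
    have hγ : γ ∈ weightPart K 1 :=
      mem_weightPart_of_X_mul (i := 3) (by simp [segreWeight]) (h0 ▸ segre_mem_weightPart (f 0))
    obtain ⟨α, β, rfl⟩ := exists_segre_of_weight_one hγ
    refine ⟨![β, α], funext fun i => segre_injective ?_⟩
    fin_cases i
    · simp [Matrix.mulVec, dotProduct, Fin.sum_univ_two, h0]
      ring
    · simp [Matrix.mulVec, dotProduct, Fin.sum_univ_two, h1]
      ring

/-- Both rows are multiples of (s, t), by a and by -b. -/
theorem mulVec_eq_zero_iff_st (f : Fin 2 → S K) :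
    (!![toS K (X 0), toS K (X 3); - toS K (X 1), - toS K (X 4)]).mulVec f = 0 ↔
      X 2 * segre K (f 0) + X 3 * segre K (f 1) = 0 := by
  have h0 : segre K ((!![toS K (X 0), toS K (X 3); - toS K (X 1), - toS K (X 4)]).mulVec f 0) =
      X 0 * (X 2 * segre K (f 0) + X 3 * segre K (f 1)) := by
    simp [Matrix.mulVec, dotProduct, Fin.sum_univ_two]
    ring
  have h1 : segre K ((!![toS K (X 0), toS K (X 3); - toS K (X 1), - toS K (X 4)]).mulVec f 1) =
      - (X 1 * (X 2 * segre K (f 0) + X 3 * segre K (f 1))) := by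
    simp [Matrix.mulVec, dotProduct, Fin.sum_univ_two]
    ring
  constructor
  · intro h
    rw [h, Pi.zero_apply, map_zero, eq_comm] at h0
    exact (mul_eq_zero.1 h0).resolve_left (X_ne_zero 0)
  · intro h
    rw [h, mul_zero] at h0 h1
    refine funext fun i => segre_injective ?_
    rw [Pi.zero_apply, map_zero]
    fin_cases i
    · exact h0
    · simpa using h1

/-- Both rows are multiples of (b, a), by t and by -s. -/
theorem mulVec_eq_zero_iff_ab (f : Fin 2 → S K) :
    (!![toS K (X 4), toS K (X 3); - toS K (X 1), - toS K (X 0)]).mulVec f = 0 ↔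
      X 1 * segre K (f 0) + X 0 * segre K (f 1) = 0 := by
  have h0 : segre K ((!![toS K (X 4), toS K (X 3); - toS K (X 1), - toS K (X 0)]).mulVec f 0) =
      X 3 * (X 1 * segre K (f 0) + X 0 * segre K (f 1)) := by
    simp [Matrix.mulVec, dotProduct, Fin.sum_univ_two]
    ring
  have h1 : segre K ((!![toS K (X 4), toS K (X 3); - toS K (X 1), - toS K (X 0)]).mulVec f 1) =
      - (X 2 * (X 1 * segre K (f 0) + X 0 * segre K (f 1))) := by
    simp [Matrix.mulVec, dotProduct, Fin.sum_univ_two]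
    ring
  constructor
  · intro h
    rw [h, Pi.zero_apply, map_zero, eq_comm] at h0
    exact (mul_eq_zero.1 h0).resolve_left (X_ne_zero 3)
  · intro h
    rw [h, mul_zero] at h0 h1
    refine funext fun i => segre_injective ?_
    rw [Pi.zero_apply, map_zero]
    fin_cases i
    · exact h0
    · simpa using h1

variable (q : ℕ)

theorem exact_φ₅_φ₄ : Function.Exact (φ₅ K q).mulVecLin (φ₄ K q).mulVecLin := by
  intro f
  rw [φ₄, φ₅, blockDiagonal_mulVec_eq_zero_iff, mem_range_blockDiagonal_iff]
  exact forall_congr' fun k => by rw [mulVec_eq_zero_iff_st, exists_mulVec_eq_iff_of_st]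

theorem exact_φ₄_φ₅ : Function.Exact (φ₄ K q).mulVecLin (φ₅ K q).mulVecLin := by
  intro f
  rw [φ₄, φ₅, blockDiagonal_mulVec_eq_zero_iff, mem_range_blockDiagonal_iff]
  exact forall_congr' fun k => by rw [mulVec_eq_zero_iff_ab, exists_mulVec_eq_iff_of_ab]

/-- The columns U_j and W_j become b and a times s e_j - t e_{j+1}. -/
theorem segre_φ₃_mulVec (f : Fin 2 × Fin q → S K) (i : Fin (q + 1)) :
    segre K ((φ₃ K q).mulVec f i) = (Fin.snoc (α := fun _ => R K)
      (fun j => X 2 * (X 1 * segre K (f (0, j)) + X 0 * segre K (f (1, j)))) 0 -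
      Fin.cons 0 (fun j => X 3 * (X 1 * segre K (f (0, j)) + X 0 * segre K (f (1, j)))) :
        Fin (q + 1) → R K) i := by
  -- The nested cases become a difference because e_j and e_{j+1} are distinct.
  have hφ : ∀ c : Fin 2 × Fin q, φ₃ K q i c =
      (if i = c.2.castSucc then toS K (![X 1, X 0] c.1) else 0) -
        (if i = c.2.succ then toS K (![X 4, X 3] c.1) else 0) := by
    rintro ⟨l, j⟩
    have hj : j.castSucc ≠ j.succ := Fin.castSucc_lt_succ.ne
    simp only [φ₃, Matrix.of_apply]
    by_cases h1 : i = j.castSucc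
    · rw [if_pos h1, if_pos h1, if_neg (h1 ▸ hj), sub_zero]
    · rw [if_neg h1, if_neg h1, zero_sub]
      split_ifs <;> simp
  rw [Matrix.mulVec, dotProduct, map_sum]
  simp only [hφ, sub_mul, map_sub, Finset.sum_sub_distrib, Pi.sub_apply]
  congr 1
  · simp only [Fintype.sum_prod_type, Fin.sum_univ_two]
    refine Fin.lastCases ?_ (fun i => ?_) i
    · simp [(Fin.castSucc_lt_last _).ne']
    · simp [apply_ite (segre K)]
      ring
  · simp only [Fintype.sum_prod_type, Fin.sum_univ_two]
    refine Fin.cases ?_ (fun i => ?_) i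
    · simp [(Fin.succ_ne_zero _).symm]
    · simp [apply_ite (segre K)]
      ring

theorem φ₃_mulVec_eq_zero_iff (f : Fin 2 × Fin q → S K) : (φ₃ K q).mulVecLin f = 0 ↔
    ∀ j, X 1 * segre K (f (0, j)) + X 0 * segre K (f (1, j)) = 0 := by
  constructor
  · intro h
    refine congr_fun (eq_zero_of_snoc_sub_cons_eq_zero (s := X 2) (t := X 3) (X_ne_zero 2) q
      (fun j => X 1 * segre K (f (0, j)) + X 0 * segre K (f (1, j))) (funext fun i => ?_))
    rw [← segre_φ₃_mulVec, ← Matrix.mulVecLin_apply, h]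
    exact map_zero _
  · intro h
    refine funext fun i => segre_injective ?_
    rw [Matrix.mulVecLin_apply, segre_φ₃_mulVec]
    simp only [h, mul_zero, Pi.sub_apply, Pi.zero_apply, map_zero]
    have h1 : ∀ i, (Fin.snoc (α := fun _ => R K) (fun _ => 0) 0 : Fin (q + 1) → R K) i = 0 :=
      fun i => Fin.lastCases (by simp) (fun i => by simp) i
    have h2 : ∀ i, (Fin.cons 0 (fun _ => 0) : Fin (q + 1) → R K) i = 0 :=
      fun i => Fin.cases (by simp) (fun i => by simp) i
    rw [h1, h2, sub_zero]

theorem exact_φ₄_φ₃ : Function.Exact (φ₄ K q).mulVecLin (φ₃ K q).mulVecLin := by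
  intro f
  rw [φ₄, φ₃_mulVec_eq_zero_iff, mem_range_blockDiagonal_iff]
  exact forall_congr' fun k => by rw [exists_mulVec_eq_iff_of_ab]

/-- In the big ring y^j v^(q-j) = b^q s^j t^(q-j), so b^q factors out of the whole row. -/
theorem segre_φ₂_mulVec_zero (c : Fin (q + 1) → S K) : segre K ((φ₂ K q).mulVec c 0) =
    X 1 ^ q * ∑ j : Fin (q + 1), X 2 ^ (j : ℕ) * X 3 ^ (q - j) * segre K (c j) := by
  simp only [φ₂, Matrix.mulVec, dotProduct, Matrix.of_apply, Matrix.cons_val_zero, map_sum,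
    map_mul, map_pow, segre_y, segre_v, mul_pow, Finset.mul_sum]
  refine Finset.sum_congr rfl fun j _ => ?_
  obtain ⟨k, hk⟩ := Nat.exists_eq_add_of_le (Nat.le_of_lt_succ j.2)
  rw [show q - j = k by omega, show (X 1 : R K) ^ q = X 1 ^ (j : ℕ) * X 1 ^ k by
    rw [← pow_add, ← hk]]
  ring

theorem segre_φ₂_mulVec_one (c : Fin (q + 1) → S K) : segre K ((φ₂ K q).mulVec c 1) =
    - (X 0 ^ q * ∑ j : Fin (q + 1), X 2 ^ (j : ℕ) * X 3 ^ (q - j) * segre K (c j)) := by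
  simp only [φ₂, Matrix.mulVec, dotProduct, Matrix.of_apply, Matrix.cons_val_one,
    Matrix.cons_val_fin_one, map_sum, map_mul, map_pow, map_neg, segre_x, segre_u, mul_pow,
    Finset.mul_sum, ← Finset.sum_neg_distrib]
  refine Finset.sum_congr rfl fun j _ => ?_
  obtain ⟨k, hk⟩ := Nat.exists_eq_add_of_le (Nat.le_of_lt_succ j.2)
  rw [show q - j = k by omega, show (X 0 : R K) ^ q = X 0 ^ (j : ℕ) * X 0 ^ k by
    rw [← pow_add, ← hk]]
  ring

theorem φ₂_mulVec_eq_zero_iff (c : Fin (q + 1) → S K) : (φ₂ K q).mulVecLin c = 0 ↔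
    ∑ j : Fin (q + 1), X 2 ^ (j : ℕ) * X 3 ^ (q - j) * segre K (c j) = 0 := by
  constructor
  · intro h
    have h0 := segre_φ₂_mulVec_zero q c
    rw [← Matrix.mulVecLin_apply, h, Pi.zero_apply, map_zero, eq_comm] at h0
    exact (mul_eq_zero.1 h0).resolve_left (pow_ne_zero _ (X_ne_zero 1))
  · intro h
    refine funext fun i => segre_injective ?_
    rw [Pi.zero_apply, map_zero, Matrix.mulVecLin_apply]
    fin_cases i
    · exact (segre_φ₂_mulVec_zero q c).trans (by rw [h, mul_zero])
    · exact (segre_φ₂_mulVec_one q c).trans (by rw [h, mul_zero, neg_zero])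

theorem exact_φ₃_φ₂ : Function.Exact (φ₃ K q).mulVecLin (φ₂ K q).mulVecLin := by
  intro c
  rw [φ₂_mulVec_eq_zero_iff]
  constructor
  · intro h
    obtain ⟨d, hd, hc⟩ := exists_eq_snoc_sub_cons (X_prime (i := (2 : Fin 6)))
      (not_X_dvd_X (K := K) (j := 3) (by decide)) (M₀ := (weightPart K 0).toAddSubgroup)
      (M₁ := (weightPart K 1).toAddSubgroup)
      (fun f hf => mem_weightPart_of_X_mul (i := 2) (by simp [segreWeight]) hf)
      (fun f hf => X_mul_mem_weightPart (by simp [segreWeight]) hf) q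
      (fun j => segre K (c j)) (fun j => segre_mem_weightPart (c j)) h
    choose α β hαβ using fun j => exists_segre_of_weight_one (hd j)
    -- With d_j = aα + bβ, the column U_j carries b and so takes β, and W_j takes α.
    refine ⟨fun i => ![β, α] i.1 i.2, funext fun i => segre_injective ?_⟩
    rw [Matrix.mulVecLin_apply, segre_φ₃_mulVec, congr_fun hc i]
    simp only [hαβ, Matrix.cons_val_zero, Matrix.cons_val_one, Matrix.cons_val_fin_one, add_comm]
  · rintro ⟨f, rfl⟩
    simp only [Matrix.mulVecLin_apply, segre_φ₃_mulVec, Pi.sub_apply, mul_sub,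
      Finset.sum_sub_distrib]
    rw [Fin.sum_univ_castSucc, Fin.sum_univ_succ]
    simp only [Fin.snoc_castSucc, Fin.snoc_last, Fin.cons_zero, Fin.cons_succ, mul_zero, add_zero,
      zero_add, Fin.val_castSucc, Fin.val_succ, ← Finset.sum_sub_distrib]
    -- The terms for s e_j and t e_{j+1} both give s^(j+1) t^(q-j) and cancel.
    refine Finset.sum_eq_zero fun j _ => ?_
    obtain ⟨k, hk⟩ := Nat.exists_eq_add_of_le (Nat.succ_le_of_lt j.2)
    rw [show q - j = k + 1 by omega, show q - (j + 1) = k by omega]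
    ring

/-- The common factor tz - sw of g₂ and g₃ splits off, leaving a^q and b^q. -/
theorem segre_φ₁_mulVec (v : Fin 2 → S K) (i : Fin 1) : segre K ((φ₁ K q).mulVec v i) =
    (X 3 * X 4 - X 2 * X 5) ^ q * (X 1 ^ q * segre K (v 1) + X 0 ^ q * segre K (v 0)) := by
  have h2 : segre K (toS K (g₂ K)) = X 0 * (X 3 * X 4 - X 2 * X 5) := by
    simp only [g₂, map_sub, map_mul, segre_x, segre_z, segre_u, segre_w]
    ring
  have h3 : segre K (toS K (g₃ K)) = X 1 * (X 3 * X 4 - X 2 * X 5) := by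
    simp only [g₃, map_sub, map_mul, segre_y, segre_z, segre_v, segre_w]
    ring
  simp [φ₁, Matrix.mulVec, dotProduct, Fin.sum_univ_two, h2, h3, mul_pow, -map_pow,
    map_pow (segre K)]
  ring

theorem minor_ne_zero : (X 3 * X 4 - X 2 * X 5 : R K) ≠ 0 := by
  intro h
  simpa using congr_arg (eval ![0, 0, 0, 1, 1, 0]) h

theorem φ₁_mulVec_eq_zero_iff (v : Fin 2 → S K) : (φ₁ K q).mulVecLin v = 0 ↔
    X 1 ^ q * segre K (v 1) + X 0 ^ q * segre K (v 0) = 0 := by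
  constructor
  · intro h
    have h0 := segre_φ₁_mulVec q v 0
    rw [← Matrix.mulVecLin_apply, h, Pi.zero_apply, map_zero, eq_comm] at h0
    exact (mul_eq_zero.1 h0).resolve_left (pow_ne_zero _ minor_ne_zero)
  · intro h
    refine funext fun i => segre_injective ?_
    rw [Pi.zero_apply, map_zero, Matrix.mulVecLin_apply, segre_φ₁_mulVec, h, mul_zero]

theorem exact_φ₂_φ₁ : Function.Exact (φ₂ K q).mulVecLin (φ₁ K q).mulVecLin := by
  intro v
  rw [φ₁_mulVec_eq_zero_iff]
  constructor
  · intro h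
    have h1 : (X 1 : R K) ^ q ∣ segre K (v 0) :=
      (X_prime (i := 1)).pow_dvd_of_dvd_mul_left (a := X 0 ^ q) q
        (fun h => not_X_dvd_X (K := K) (i := 1) (j := 0) (by decide) ((X_prime (i := 1)).dvd_of_dvd_pow h))
        ⟨- segre K (v 1), by linear_combination h⟩
    obtain ⟨γ, hγ⟩ := h1
    have hγ' : γ ∈ weightPart K (-q) := mem_weightPart_of_X_pow_mul (i := 1) (k := q)
      (by simp [segreWeight]) (hγ ▸ segre_mem_weightPart (v 0))
    obtain ⟨c, hc⟩ := exists_segre_of_weight_neg hγ'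
    refine ⟨c, funext fun i => segre_injective ?_⟩
    rw [Matrix.mulVecLin_apply]
    fin_cases i
    · exact (segre_φ₂_mulVec_zero q c).trans (by rw [← hc]; exact hγ.symm)
    · refine (segre_φ₂_mulVec_one q c).trans ?_
      rw [← hc]
      -- The second coordinate is forced: after multiplication by b^q it is the given relation with
      -- b^q γ substituted for the first.
      refine mul_left_cancel₀ (pow_ne_zero q (X_ne_zero 1)) ?_
      change _ = _ * segre K (v 1)
      rw [hγ] at h
      linear_combination -h
  · rintro ⟨c, rfl⟩
    rw [Matrix.mulVecLin_apply, segre_φ₂_mulVec_zero, segre_φ₂_mulVec_one]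
    ring

theorem exact_φ₁_augmentation : Function.Exact (φ₁ K q).mulVecLin (augmentation K q) := by
  intro f
  change (J K q).mkQ (f 0) = 0 ↔ _
  rw [Submodule.mkQ_apply, Submodule.Quotient.mk_eq_zero, J, Ideal.mem_span_pair]
  constructor
  · rintro ⟨α, β, h⟩
    refine ⟨![α, β], funext fun i => ?_⟩
    rw [Subsingleton.elim i (0 : Fin 1), ← h]
    simp [φ₁, Matrix.mulVec, dotProduct, Fin.sum_univ_two, mul_comm]
  · rintro ⟨v, rfl⟩
    refine ⟨v 0, v 1, ?_⟩
    simp [φ₁, Matrix.mulVec, dotProduct, Fin.sum_univ_two, mul_comm]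

end Exactness

/-! ### Degrees of the entries, and assembly of the resolution. -/

section Grading

variable (K : Type*) [Field K] (q : ℕ)

theorem toS_mem_gradingS {f : R K} {n : ℕ} (hf : f.IsHomogeneous n) : toS K f ∈ gradingS K n :=
  mk_mem_quotientGrading hf

theorem toS_X_mem_gradingS (i : Fin 6) : toS K (X i) ∈ gradingS K 1 :=
  toS_mem_gradingS K (isHomogeneous_X K i)

theorem φ₁_mem_gradingS (i : Fin 1) (j : Fin 2) : φ₁ K q i j ∈ gradingS K (2 * q) := by
  have h2 : (g₂ K).IsHomogeneous 2 := ((isHomogeneous_X K 2).mul (isHomogeneous_X K 3)).sub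
    ((isHomogeneous_X K 0).mul (isHomogeneous_X K 5))
  have h3 : (g₃ K).IsHomogeneous 2 := ((isHomogeneous_X K 2).mul (isHomogeneous_X K 4)).sub
    ((isHomogeneous_X K 1).mul (isHomogeneous_X K 5))
  rw [Subsingleton.elim i 0]
  fin_cases j
  · change toS K (g₂ K) ^ q ∈ _
    rw [← map_pow]
    exact toS_mem_gradingS K (h2.pow q)
  · change toS K (g₃ K) ^ q ∈ _
    rw [← map_pow]
    exact toS_mem_gradingS K (h3.pow q)

theorem φ₂_mem_gradingS (i : Fin 2) (j : Fin (q + 1)) : φ₂ K q i j ∈ gradingS K q := by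
  have h : ∀ k l : Fin 6, (X k ^ (j : ℕ) * X l ^ (q - j) : R K).IsHomogeneous q := by
    intro k l
    have := (isHomogeneous_X_pow (R := K) k j).mul (isHomogeneous_X_pow l (q - j))
    rwa [Nat.add_sub_of_le (Nat.le_of_lt_succ j.2)] at this
  fin_cases i
  · exact toS_mem_gradingS K (h 1 4)
  · exact Submodule.neg_mem _ (toS_mem_gradingS K (h 0 3))

theorem φ₃_mem_gradingS (i : Fin (q + 1)) (j : Fin 2 × Fin q) : φ₃ K q i j ∈ gradingS K 1 := by
  obtain ⟨l, j⟩ := j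
  simp only [φ₃, Matrix.of_apply]
  split_ifs
  · fin_cases l <;> exact toS_X_mem_gradingS K _
  · fin_cases l <;> exact Submodule.neg_mem _ (toS_X_mem_gradingS K _)
  · exact Submodule.zero_mem _

theorem φ₄_mem_gradingS (i j : Fin 2 × Fin q) : φ₄ K q i j ∈ gradingS K 1 := by
  obtain ⟨k, i⟩ := i
  obtain ⟨l, j⟩ := j
  rw [φ₄, Matrix.blockDiagonal_apply]
  split_ifs
  · fin_cases k <;> fin_cases l
    · exact toS_X_mem_gradingS K _
    · exact toS_X_mem_gradingS K _
    · exact Submodule.neg_mem _ (toS_X_mem_gradingS K _)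
    · exact Submodule.neg_mem _ (toS_X_mem_gradingS K _)
  · exact Submodule.zero_mem _

theorem φ₅_mem_gradingS (i j : Fin 2 × Fin q) : φ₅ K q i j ∈ gradingS K 1 := by
  obtain ⟨k, i⟩ := i
  obtain ⟨l, j⟩ := j
  rw [φ₅, Matrix.blockDiagonal_apply]
  split_ifs
  · fin_cases k <;> fin_cases l
    · exact toS_X_mem_gradingS K _
    · exact toS_X_mem_gradingS K _
    · exact Submodule.neg_mem _ (toS_X_mem_gradingS K _)
    · exact Submodule.neg_mem _ (toS_X_mem_gradingS K _)
  · exact Submodule.zero_mem _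

theorem differential_mem_gradingS_one (k : ℕ) (i : idx q (k + 2)) (j : idx q (k + 3)) :
    differential K q (k + 2) i j ∈ gradingS K 1 := by
  cases k with
  | zero => exact φ₃_mem_gradingS K q i j
  | succ k =>
    by_cases h : Even k
    · have : differential K q (k + 3) = φ₄ K q := if_pos h
      rw [show differential K q (k + 1 + 2) = φ₄ K q from this]
      exact φ₄_mem_gradingS K q i j
    · rw [show differential K q (k + 1 + 2) = φ₅ K q from if_neg h]
      exact φ₅_mem_gradingS K q i j

/-- One degree m per differential serves twice: as the difference of shifts it gives homogeneity,
and its positivity gives minimality. For q = 0 the entries of φ₁ and φ₂ would be units. -/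
theorem differential_mem_gradingS (hq : 0 < q) (k : ℕ) : ∃ m, 0 < m ∧
    shift q (k + 1) = shift q k + m ∧ ∀ i j, differential K q k i j ∈ gradingS K m := by
  match k with
  | 0 => exact ⟨2 * q, by omega, by simp [shift], φ₁_mem_gradingS K q⟩
  | 1 => exact ⟨q, hq, by simp [shift]; ring, φ₂_mem_gradingS K q⟩
  | 2 => exact ⟨1, one_pos, rfl, differential_mem_gradingS_one K q 0⟩
  | k + 3 => exact ⟨1, one_pos, rfl, differential_mem_gradingS_one K q (k + 1)⟩

theorem exact_differential (k : ℕ) : Function.Exact (differential K q (k + 1)).mulVecLin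
    (differential K q k).mulVecLin := by
  match k with
  | 0 => exact exact_φ₂_φ₁ q
  | 1 => exact exact_φ₃_φ₂ q
  | 2 => exact exact_φ₄_φ₃ q
  | k + 3 =>
    by_cases h : Even k
    · rw [show differential K q (k + 3) = φ₄ K q from if_pos h,
        show differential K q (k + 3 + 1) = φ₅ K q from if_neg (by simpa [Nat.even_add_one] using h)]
      exact exact_φ₅_φ₄ q
    · rw [show differential K q (k + 3) = φ₅ K q from if_neg h,
        show differential K q (k + 3 + 1) = φ₄ K q from if_pos (Nat.even_add_one.2 h)]
      exact exact_φ₄_φ₅ q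

theorem isMinimalGradedFreeResolution (hq : 0 < q) :
    IsMinimalGradedFreeResolution (gradingS K) (quotientGrading (gradingS K) (J K q))
      (idx q) (fun i _ => shift q i) (differential K q) (augmentation K q) where
  augmentation_surjective b := by
    obtain ⟨s, rfl⟩ := Submodule.mkQ_surjective _ b
    exact ⟨fun _ => s, rfl⟩
  exact_zero := exact_φ₁_augmentation q
  exact_succ := exact_differential K q
  augmentation_graded n f hf := by
    have h : f (0 : Fin 1) ∈ gradingS K n := by
      have := hf (0 : Fin 1) trivial
      simpa [shift] using this
    exact mk_mem_quotientGrading h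
  differential_graded i n f hf := by
    obtain ⟨m, -, hm, h⟩ := differential_mem_gradingS K q hq i
    exact mulVec_mem_twistedPiece (gradingS K) hm h hf
  minimal i := by
    obtain ⟨m, hm, -, h⟩ := differential_mem_gradingS K q hq i
    exact range_mulVecLin_le_smul_top _ fun j k =>
      HomogeneousIdeal.mem_irrelevant_of_mem (gradingS K) hm (h j k)

end Grading

end DetRes

end

theorem mainTheorem6 (K : Type*) [Field K] (p : ℕ) [Fact p.Prime] [CharP K p] (e q : ℕ)
    (hq : q = p ^ e) :
    DetRes.IsMinimalGradedFreeResolution (DetRes.gradingS K)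
        (DetRes.quotientGrading (DetRes.gradingS K) (DetRes.J K q))
        (DetRes.idx q) (fun i _ => DetRes.shift q i)
        (DetRes.differential K q) (DetRes.augmentation K q) ∧
      (∀ k i j, DetRes.differential K q (k + 2) i j ∈ DetRes.gradingS K 1) ∧
      (∀ k, (DetRes.differential K q (k + 5) :
          Matrix (Fin 2 × Fin q) (Fin 2 × Fin q) (DetRes.S K)) =
        DetRes.differential K q (k + 3)) := by
  refine ⟨DetRes.isMinimalGradedFreeResolution K q ?_, DetRes.differential_mem_gradingS_one K q,
    fun k => ?_⟩
  · rw [hq]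
    exact pow_pos (Fact.out : p.Prime).pos e
  -- Periodicity amounts to k + 2 and k having the same parity.
  · change (if Even (k + 2) then DetRes.φ₄ K q else DetRes.φ₅ K q) =
      if Even k then DetRes.φ₄ K q else DetRes.φ₅ K q
    simp [Nat.even_add]
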